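/- Let $\Pi:=([0,1]\times\{0,1\})^{\infty}$ with the product topology, and let $\Pi^{\diamond}:=\bigcup_{n\ge 0}([0,1]\times\{0,1\})^n$ be the set of finite sequences of forecasts and outcomes, with empty sequence $\Lambda$. For $\pi=(p_1,y_1,p_2,y_2,\ldots)\in\Pi$ put $\pi^n:=(p_1,y_1,\ldots,p_n,y_n)$. A non-negative farthingale is a function $V:\Pi^{\diamond}\to[0,\infty]$ such that $$V(x)=(1-p)\,V(x,p,0)+p\,V(x,p,1)\qquad\text{for all }x\in\Pi^{\diamond},\ p\in[0,1],$$ where $0\cdot\infty:=0$. The upper game-theoretic probability of an arbitrary set $E\subseteq\Pi$ is $$\overline{\mathbb P}(E):=\inf\Bigl\{V(\Lambda)\;:\;V\text{ is a non-negative farthingale with }\limsup_{n\to\infty}V(\pi^n)\ge 1\text{ for all }\pi\in E\Bigr\}.$$ Theorem 3. The set function $\overline{\mathbb P}$ is a (Choquet) capacity on $\Pi$. That is, it takes values in $[0,\infty)$, and: (i) if $A\subseteq B\subseteq\Pi$, then $\overline{\mathbb P}(A)\le\overline{\mathbb P}(B)$; (ii) for every increasing sequence $A_1\subseteq A_2\subseteq\cdots$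 of arbitrary subsets of $\Pi$, $\overline{\mathbb P}\bigl(\bigcup_{i=1}^{\infty}A_i\bigr)=\lim_{i\to\infty}\overline{\mathbb P}(A_i)$; (iii) for every decreasing sequence $K_1\supseteq K_2\supseteq\cdots$ of compact subsets of $\Pi$, $\overline{\mathbb P}\bigl(\bigcap_{i=1}^{\infty}K_i\bigr)=\lim_{i\to\infty}\overline{\mathbb P}(K_i)$. -/

import Mathlib

open Filter Topology
open scoped ENNReal

namespace Prequential

/-- One round of the protocol: a forecast `p ∈ [0,1]` followed by an outcome `y ∈ {0,1}`. -/
abbrev Round : Type := unitInterval × Fin 2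

/-- Finite sequences of forecasts and outcomes `(p₁, y₁, …, pₙ, yₙ)`, `n ≥ 0`. -/
abbrev FiniteSeq : Type := List Round

/-- The prequential space `([0,1] × {0,1})^∞`, with the product topology. -/
abbrev Space : Type := ℕ → Round

/-- `initial π n` is the sequence of the first `n` rounds of `π`. -/
def initial (π : Space) (n : ℕ) : FiniteSeq := List.ofFn fun i : Fin n => π i

/-- `V` is a non-negative farthingale: a function with values in `[0, ∞]` such that
`V(x) = (1 - p) V(x, p, 0) + p V(x, p, 1)` for all finite sequences `x` and all `p ∈ [0,1]`.
Multiplication on `ℝ≥0∞` obeys `0 * ∞ = 0`. -/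
def IsNonnegFarthingale (V : FiniteSeq → ℝ≥0∞) : Prop :=
  ∀ (x : FiniteSeq) (p : unitInterval),
    V x = ENNReal.ofReal (1 - (p : ℝ)) * V (x ++ [(p, 0)])
      + ENNReal.ofReal (p : ℝ) * V (x ++ [(p, 1)])

/-- The upper game-theoretic probability of a prequential event `E`. -/
noncomputable def upperProb (E : Set Space) : ℝ≥0∞ :=
  sInf {a : ℝ≥0∞ | ∃ V : FiniteSeq → ℝ≥0∞, IsNonnegFarthingale V ∧ V [] = a ∧
    ∀ π ∈ E, 1 ≤ limsup (fun n : ℕ => V (initial π n)) atTop}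

/-- `γ` is a (Choquet) capacity on the topological space `X`. -/
structure IsCapacity {X : Type*} [TopologicalSpace X] (γ : Set X → ℝ≥0∞) : Prop where
  /-- The values lie in `[0, ∞)`. -/
  ne_top : ∀ A : Set X, γ A ≠ ∞
  /-- Monotonicity. -/
  mono : ∀ A B : Set X, A ⊆ B → γ A ≤ γ B
  /-- Continuity along increasing sequences of arbitrary sets. -/
  tendsto_iUnion : ∀ A : ℕ → Set X, Monotone A →
    Tendsto (fun i => γ (A i)) atTop (𝓝 (γ (⋃ i, A i)))
  /-- Continuity along decreasing sequences of compact sets. -/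
  tendsto_iInter : ∀ K : ℕ → Set X, Antitone K → (∀ i, IsCompact (K i)) →
    Tendsto (fun i => γ (K i)) atTop (𝓝 (γ (⋂ i, K i)))

end Prequential

namespace Prequential

/-! Superfarthingales may replace farthingales in the definition of `upperProb`
(`upperProb_le_of_limsup`), and strategies may be switched at a hitting time
(`upperProb_le_of_hitting`).

Increasing sets: by Lévy's zero-one law (`upperProb_exceptional`), the conditional upper probability
of `A i` tends to 1 on `A i` off a null set. Hence the supremum over `i` of these superfarthingales,
plus a cheap one for the null sets, succeeds on the union.

Decreasing compact sets: a superfarthingale that starts below the limit of the upper probabilities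
stays below 1 along some play (`CanStayBelow.exists_append`). Compactness of the forecast space
yields each next forecast, and closedness puts the play in the intersection. -/

/-- The expectation of `f` when the outcome `1` has probability `p`. -/
noncomputable def average (p : unitInterval) (f : Fin 2 → ℝ≥0∞) : ℝ≥0∞ :=
  ENNReal.ofReal (1 - (p : ℝ)) * f 0 + ENNReal.ofReal (p : ℝ) * f 1

theorem weights_add (p : unitInterval) :
    ENNReal.ofReal (1 - (p : ℝ)) + ENNReal.ofReal (p : ℝ) = 1 := by
  rw [← ENNReal.ofReal_add (by linarith [p.2.2]) p.2.1]
  simp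

theorem average_mono (p : unitInterval) {f g : Fin 2 → ℝ≥0∞} (h : ∀ y, f y ≤ g y) :
    average p f ≤ average p g :=
  add_le_add (mul_le_mul_right (h 0) _) (mul_le_mul_right (h 1) _)

theorem average_const (p : unitInterval) (c : ℝ≥0∞) : average p (fun _ => c) = c := by
  simp only [average, ← add_mul, weights_add, one_mul]

theorem average_add (p : unitInterval) (f g : Fin 2 → ℝ≥0∞) :
    average p (fun y => f y + g y) = average p f + average p g := by
  simp only [average]
  ring

theorem average_mul_const (p : unitInterval) (f : Fin 2 → ℝ≥0∞) (c : ℝ≥0∞) :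
    average p (fun y => f y * c) = average p f * c := by
  simp only [average]
  ring

theorem average_tsum (p : unitInterval) (f : ℕ → Fin 2 → ℝ≥0∞) :
    average p (fun y => ∑' i, f i y) = ∑' i, average p (f i) := by
  simp only [average, ENNReal.tsum_add, ENNReal.tsum_mul_left]

theorem tendsto_average {ι : Type*} {l : Filter ι} (p : unitInterval) {f : ι → Fin 2 → ℝ≥0∞}
    {g : Fin 2 → ℝ≥0∞} (h : ∀ y, Tendsto (fun i => f i y) l (𝓝 (g y))) :
    Tendsto (fun i => average p (f i)) l (𝓝 (average p g)) :=
  (ENNReal.Tendsto.const_mul (h 0) (Or.inr ENNReal.ofReal_ne_top)).add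
    (ENNReal.Tendsto.const_mul (h 1) (Or.inr ENNReal.ofReal_ne_top))

theorem continuous_average {f : Fin 2 → ℝ≥0∞} (hf : ∀ y, f y ≠ ∞) :
    Continuous fun p => average p f := by
  have h (y : Fin 2) {w : unitInterval → ℝ} (hw : Continuous w) :
      Continuous fun p => ENNReal.ofReal (w p) * f y :=
    ENNReal.continuous_mul_const (hf y) |>.comp (ENNReal.continuous_ofReal.comp hw)
  exact (h 0 (by fun_prop)).add (h 1 (by fun_prop))

/-! ### Superfarthingales and their compensation -/

/-- `V` is a non-negative superfarthingale: it does not increase on average. -/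
def IsSuperfarthingale (V : FiniteSeq → ℝ≥0∞) : Prop :=
  ∀ (x : FiniteSeq) (p : unitInterval), average p (fun y => V (x ++ [(p, y)])) ≤ V x

/-- The process started from capital `m` that gains at each
step the increment of `V` over its average. -/
noncomputable def compensated (V : FiniteSeq → ℝ≥0∞) (m : ℝ≥0∞) : FiniteSeq → ℝ≥0∞
  | [] => m
  | r :: x => compensated (fun z => V (r :: z))
      (if m = ∞ then ∞ else m - average r.1 (fun y => V [(r.1, y)]) + V [r]) x

theorem IsSuperfarthingale.cons {V : FiniteSeq → ℝ≥0∞} (hV : IsSuperfarthingale V) (r : Round) :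
    IsSuperfarthingale fun z => V (r :: z) := fun x p => hV (r :: x) p

theorem le_compensation_step {V : FiniteSeq → ℝ≥0∞} (m : ℝ≥0∞) (r : Round) :
    V [r] ≤ if m = ∞ then ∞ else m - average r.1 (fun y => V [(r.1, y)]) + V [r] := by
  split_ifs
  · exact le_top
  · exact le_add_self

theorem le_compensated {V : FiniteSeq → ℝ≥0∞} {m : ℝ≥0∞} (hm : V [] ≤ m) (x : FiniteSeq) :
    V x ≤ compensated V m x := by
  induction x generalizing V m with
  | nil => exact hm
  | cons r x ih => exact ih (V := fun z => V (r :: z)) (le_compensation_step m r)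

/-- The capital keeps dominating `V`, hence the next average of `V`, so the truncated subtraction is
exact. -/
theorem average_compensated {V : FiniteSeq → ℝ≥0∞} (hV : IsSuperfarthingale V) {m : ℝ≥0∞}
    (hm : V [] ≤ m) (x : FiniteSeq) (p : unitInterval) :
    average p (fun y => compensated V m (x ++ [(p, y)])) = compensated V m x := by
  induction x generalizing V m with
  | nil =>
    simp only [List.nil_append, compensated]
    split_ifs with h
    · rw [average_const, h]
    · rw [average_add, average_const]
      exact tsub_add_cancel_of_le ((hV [] p).trans hm)
  | cons r x ih => exact ih (hV.cons r) (le_compensation_step m r)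

/-! ### Plays and continuations -/

theorem initial_zero (π : Space) : initial π 0 = [] := by simp [initial]

/-- The sequence with first round `r` followed by `π`. -/
def cons (r : Round) (π : Space) : Space
  | 0 => r
  | n + 1 => π n

theorem initial_cons_succ (r : Round) (π : Space) (n : ℕ) :
    initial (cons r π) (n + 1) = r :: initial π n := by
  simp [initial, List.ofFn_succ, cons]

theorem cons_zero_succ (π : Space) : cons (π 0) (fun n => π (n + 1)) = π := by
  funext n
  cases n <;> rfl

/-- The sequence that starts with the rounds of `x` and goes on with `π`. -/
def prepend : FiniteSeq → Space → Space
  | [], π => π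
  | r :: x, π => cons r (prepend x π)

theorem prepend_append (x z : FiniteSeq) (π : Space) :
    prepend (x ++ z) π = prepend x (prepend z π) := by
  induction x with
  | nil => rfl
  | cons r x ih => simp only [List.cons_append, prepend, ih]

theorem initial_prepend (x : FiniteSeq) (π : Space) (n : ℕ) :
    initial (prepend x π) (n + x.length) = x ++ initial π n := by
  induction x with
  | nil => rfl
  | cons r x ih => rw [List.length_cons, ← add_assoc, prepend, initial_cons_succ, ih]; rfl

theorem initial_succ (π : Space) (n : ℕ) : initial π (n + 1) = initial π n ++ [π n] := by
  rw [initial, List.ofFn_succ_last]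
  rfl

theorem prepend_initial_apply (π ρ : Space) {n k : ℕ} (h : k < n) :
    prepend (initial π n) ρ k = π k := by
  induction n generalizing π k with
  | zero => omega
  | succ n ih =>
    rw [← cons_zero_succ π, initial_cons_succ]
    cases k with
    | zero => rfl
    | succ k => exact ih _ (by omega)

/-- The continuations of `x` that belong to `E`. -/
def continuations (E : Set Space) (x : FiniteSeq) : Set Space := {π | prepend x π ∈ E}

theorem continuations_append (E : Set Space) (x z : FiniteSeq) :
    continuations E (x ++ z) = continuations (continuations E x) z := by
  ext π
  simp only [continuations, Set.mem_ofPred_eq, prepend_append]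

theorem limsup_prepend (V : FiniteSeq → ℝ≥0∞) (x : FiniteSeq) (π : Space) :
    limsup (fun n => V (initial (prepend x π) n)) atTop =
      limsup (fun n => V (x ++ initial π n)) atTop := by
  rw [← limsup_nat_add _ x.length]
  simp only [initial_prepend]

/-! ### Upper probability through superfarthingales -/

theorem upperProb_mono {A B : Set Space} (h : A ⊆ B) : upperProb A ≤ upperProb B :=
  sInf_le_sInf fun _ ⟨V, hV, hV0, hB⟩ => ⟨V, hV, hV0, fun π hπ => hB π (h hπ)⟩

theorem upperProb_le_of_limsup {V : FiniteSeq → ℝ≥0∞} (hV : IsSuperfarthingale V) {E : Set Space}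
    (hE : ∀ π ∈ E, 1 ≤ limsup (fun n => V (initial π n)) atTop) : upperProb E ≤ V [] :=
  sInf_le ⟨compensated V (V []), fun x p => (average_compensated hV le_rfl x p).symm, rfl,
    fun π hπ => (hE π hπ).trans
      (limsup_le_limsup (.of_forall fun _ => le_compensated le_rfl _))⟩

theorem exists_superfarthingale_of_lt {E : Set Space} {a : ℝ≥0∞} (h : upperProb E < a) :
    ∃ V, IsSuperfarthingale V ∧ V [] < a ∧
      ∀ π ∈ E, 1 ≤ limsup (fun n => V (initial π n)) atTop := by
  obtain ⟨_, ⟨V, hV, rfl, hE⟩, ha⟩ := sInf_lt_iff.1 h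
  exact ⟨V, fun x p => (hV x p).ge, ha, hE⟩

theorem isSuperfarthingale_const (c : ℝ≥0∞) : IsSuperfarthingale fun _ => c :=
  fun _ p => (average_const p c).le

theorem IsSuperfarthingale.mul_const {V : FiniteSeq → ℝ≥0∞} (hV : IsSuperfarthingale V)
    (c : ℝ≥0∞) : IsSuperfarthingale fun x => V x * c :=
  fun x p => (average_mul_const p _ c).trans_le (mul_le_mul_left (hV x p) c)

theorem IsSuperfarthingale.add {V W : FiniteSeq → ℝ≥0∞} (hV : IsSuperfarthingale V)
    (hW : IsSuperfarthingale W) : IsSuperfarthingale fun x => V x + W x :=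
  fun x p => (average_add p _ _).trans_le (add_le_add (hV x p) (hW x p))

theorem IsSuperfarthingale.tsum {V : ℕ → FiniteSeq → ℝ≥0∞} (hV : ∀ i, IsSuperfarthingale (V i)) :
    IsSuperfarthingale fun x => ∑' i, V i x :=
  fun x p => (average_tsum p _).trans_le (ENNReal.tsum_le_tsum fun i => hV i x p)

theorem upperProb_le_one (E : Set Space) : upperProb E ≤ 1 :=
  upperProb_le_of_limsup (isSuperfarthingale_const 1) fun _ _ => by simp

theorem upperProb_ne_top (E : Set Space) : upperProb E ≠ ∞ :=
  ((upperProb_le_one E).trans_lt ENNReal.one_lt_top).ne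

theorem upperProb_empty : upperProb ∅ = 0 :=
  le_zero_iff.1 (upperProb_le_of_limsup (isSuperfarthingale_const 0) fun _ h => h.elim)

/-- The slack below `a` pays for scaling by `d / c > 1`, which turns a limsup of at least 1 into
actually reaching 1. -/
theorem exists_superfarthingale_hitting_of_lt {E : Set Space} {a : ℝ≥0∞} (h : upperProb E < a) :
    ∃ V, IsSuperfarthingale V ∧ V [] < a ∧ ∀ π ∈ E, ∃ n, 1 ≤ V (initial π n) := by
  obtain ⟨c, hEc, hca⟩ := exists_between h
  obtain ⟨V, hV, hVc, hE⟩ := exists_superfarthingale_of_lt hEc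
  have hc0 : c ≠ 0 := (bot_le.trans_lt hEc).ne'
  have hct : c ≠ ∞ := hca.ne_top
  obtain ⟨d, hcd, hda⟩ := exists_between hca
  have hd0 : d ≠ 0 := (bot_le.trans_lt hcd).ne'
  have hdt : d ≠ ∞ := hda.ne_top
  refine ⟨fun x => V x * (d / c), hV.mul_const _, ?_, fun π hπ => ?_⟩
  · calc V [] * (d / c) ≤ c * (d / c) := mul_le_mul_left hVc.le _
      _ = d := ENNReal.mul_div_cancel hc0 hct
      _ < a := hda
  · have hlt : c / d < 1 := by
      rw [ENNReal.div_lt_iff (Or.inl hd0) (Or.inl hdt), one_mul]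
      exact hcd
    obtain ⟨n, hn⟩ := (frequently_lt_of_lt_limsup (by isBoundedDefault)
      (hlt.trans_le (hE π hπ))).exists
    refine ⟨n, ?_⟩
    calc (1 : ℝ≥0∞) = c / d * (d / c) := by
          rw [← ENNReal.inv_div (Or.inl hct) (Or.inl hc0), ENNReal.inv_mul_cancel]
          · exact ENNReal.div_ne_zero.2 ⟨hd0, hct⟩
          · exact ENNReal.div_ne_top hdt hc0
      _ ≤ V (initial π n) * (d / c) := mul_le_mul_left hn.le _

/-! ### Switching strategies at a hitting time -/

open Classical in
/-- The process that, after `x`, follows `V` until the first time the play is in `S`, and switches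
at `s ∈ S` to the process `W s`. -/
noncomputable def switched (S : Set FiniteSeq) (V : FiniteSeq → ℝ≥0∞)
    (W : FiniteSeq → FiniteSeq → ℝ≥0∞) : FiniteSeq → FiniteSeq → ℝ≥0∞
  | x, [] => if x ∈ S then W x [] else V x
  | x, r :: z => if x ∈ S then W x (r :: z) else switched S V W (x ++ [r]) z

section Switched

variable {S : Set FiniteSeq} {V : FiniteSeq → ℝ≥0∞} {W : FiniteSeq → FiniteSeq → ℝ≥0∞}

theorem switched_of_mem {x : FiniteSeq} (hx : x ∈ S) (z : FiniteSeq) :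
    switched S V W x z = W x z := by
  cases z <;> simp [switched, hx]

theorem switched_cons_of_notMem {x : FiniteSeq} (hx : x ∉ S) (r : Round) (z : FiniteSeq) :
    switched S V W x (r :: z) = switched S V W (x ++ [r]) z := by
  simp [switched, hx]

theorem switched_nil_le (hW : ∀ s ∈ S, W s [] ≤ V s) (x : FiniteSeq) :
    switched S V W x [] ≤ V x := by
  by_cases hx : x ∈ S
  · rw [switched_of_mem hx]
    exact hW x hx
  · simp [switched, hx]

theorem isSuperfarthingale_switched (hV : IsSuperfarthingale V)
    (hW : ∀ s ∈ S, IsSuperfarthingale (W s)) (hWV : ∀ s ∈ S, W s [] ≤ V s) (x : FiniteSeq) :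
    IsSuperfarthingale (switched S V W x) := by
  intro z p
  induction z generalizing x with
  | nil =>
    by_cases hx : x ∈ S
    · simp only [switched_of_mem hx]
      exact hW x hx [] p
    · simp only [List.nil_append, switched_cons_of_notMem hx]
      refine (average_mono p fun y => switched_nil_le hWV _).trans ((hV x p).trans ?_)
      simp [switched, hx]
  | cons r z ih =>
    by_cases hx : x ∈ S
    · simp only [switched_of_mem hx]
      exact hW x hx (r :: z) p
    · simp only [List.cons_append, switched_cons_of_notMem hx]
      exact ih _

theorem one_le_limsup_switched {E : Set Space}
    (hW : ∀ s ∈ S, ∀ π ∈ continuations E s, 1 ≤ limsup (fun n => W s (initial π n)) atTop)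
    (n : ℕ) (x : FiniteSeq) (π : Space) (hπ : π ∈ continuations E x)
    (hn : x ++ initial π n ∈ S) :
    1 ≤ limsup (fun n => switched S V W x (initial π n)) atTop := by
  by_cases hx : x ∈ S
  · simp only [switched_of_mem hx]
    exact hW x hx π hπ
  induction n generalizing x π with
  | zero =>
    rw [initial_zero, List.append_nil] at hn
    exact absurd hn hx
  | succ n ih =>
    obtain ⟨r, ρ, rfl⟩ : ∃ r ρ, π = cons r ρ := ⟨_, _, (cons_zero_succ π).symm⟩
    rw [← limsup_nat_add _ 1]
    simp only [initial_cons_succ, switched_cons_of_notMem hx]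
    have hρ : ρ ∈ continuations E (x ++ [r]) := by
      rw [continuations_append]
      exact hπ
    by_cases hxr : x ++ [r] ∈ S
    · simp only [switched_of_mem hxr]
      exact hW _ hxr ρ hρ
    · refine ih _ ρ hρ ?_ hxr
      rw [initial_cons_succ] at hn
      simpa using hn

end Switched

/-- A superfarthingale that always reaches at some time the conditional upper probability of `E`
starts at the upper probability of `E` at least. -/
theorem upperProb_le_of_hitting {V : FiniteSeq → ℝ≥0∞} (hV : IsSuperfarthingale V) {E : Set Space}
    (hE : ∀ π ∈ E, ∃ n, upperProb (continuations E (initial π n)) ≤ V (initial π n)) :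
    upperProb E ≤ V [] := by
  refine ENNReal.le_of_forall_pos_le_add fun ε hε _ => ?_
  have hε' : (ε : ℝ≥0∞) ≠ 0 := by exact_mod_cast hε.ne'
  -- The infimum need not be attained; as there is only one switch, an extra `ε` suffices.
  have hex (s : FiniteSeq) :=
    exists_superfarthingale_of_lt (ENNReal.lt_add_right (upperProb_ne_top (continuations E s)) hε')
  choose W hW hWs hWE using hex
  let S : Set FiniteSeq := {s | upperProb (continuations E s) ≤ V s}
  have hS (s) (hs : s ∈ S) : W s [] ≤ V s + ε := (hWs s).le.trans (add_le_add_left hs _)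
  refine (upperProb_le_of_limsup
    (isSuperfarthingale_switched (S := S) (hV.add (isSuperfarthingale_const ε))
      (fun s _ => hW s) hS []) fun π hπ => ?_).trans (switched_nil_le hS [])
  obtain ⟨n, hn⟩ := hE π hπ
  exact one_le_limsup_switched (fun s _ => hWE s) n [] π hπ hn

/-! ### Conditional upper probability and the zero-one law -/

theorem isSuperfarthingale_upperProb (E : Set Space) :
    IsSuperfarthingale fun x => upperProb (continuations E x) := by
  intro x p
  refine le_of_forall_gt fun a ha => ?_
  obtain ⟨V, hV, hVa, hE⟩ := exists_superfarthingale_of_lt ha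
  refine ((average_mono p fun y => ?_).trans (hV [] p)).trans_lt hVa
  simp only [continuations_append]
  refine upperProb_le_of_limsup (V := fun z => V ([(p, y)] ++ z)) (hV.cons _) fun π hπ => ?_
  exact (hE _ hπ).trans_eq (limsup_prepend V _ π)

theorem upperProb_le_of_average_le {E : Set Space} {c : ℝ≥0∞}
    (h : ∀ p, average p (fun y => upperProb (continuations E [(p, y)])) ≤ c) :
    upperProb E ≤ c := by
  refine upperProb_le_of_hitting
    (V := fun x => if x = [] then c else upperProb (continuations E x)) (fun x p => ?_)
    fun π _ => ⟨1, ?_⟩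
  · have hne (y : Fin 2) : x ++ [(p, y)] ≠ [] := by simp
    simp only [hne, if_false]
    split_ifs with hx
    · subst hx
      exact h p
    · exact isSuperfarthingale_upperProb E x p
  · rw [if_neg (by simp [initial_succ])]

/-- The points of `E` along which the conditional upper probability of `E` does not stay
above `a`. -/
def exceptional (E : Set Space) (a : ℝ≥0∞) : Set Space :=
  {π ∈ E | ∃ᶠ n in atTop, upperProb (continuations E (initial π n)) < a}

theorem continuations_exceptional_subset (E : Set Space) (a : ℝ≥0∞) (x : FiniteSeq) :
    continuations (exceptional E a) x ⊆ exceptional (continuations E x) a := by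
  rintro π ⟨hE, hf⟩
  refine ⟨hE, ?_⟩
  rw [← map_add_atTop_eq_nat x.length, frequently_map] at hf
  simpa only [initial_prepend, continuations_append] using hf

/-- Lévy's zero-one law. -/
theorem upperProb_exceptional (E : Set Space) {a : ℝ≥0∞} (ha : a < 1) :
    upperProb (exceptional E a) = 0 := by
  -- Each drop of the conditional upper probability below `a` lets the capital grow by a factor `1 /
  -- a`, and on `exceptional E a` this recurs forever.
  have key (k : ℕ) : ∀ E, upperProb (exceptional E a) ≤ a ^ k := by
    induction k with
    | zero => simpa using fun E => upperProb_le_one _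
    | succ k ih =>
      have hlt (E : Set Space) (hE : upperProb E < a) :
          upperProb (exceptional E a) ≤ a * a ^ k := by
        obtain ⟨V, hV, hVa, hVE⟩ := exists_superfarthingale_hitting_of_lt hE
        refine (upperProb_le_of_hitting (hV.mul_const (a ^ k)) fun π hπ => ?_).trans
          (mul_le_mul_left hVa.le _)
        obtain ⟨n, hn⟩ := hVE π hπ.1
        exact ⟨n, ((upperProb_mono (continuations_exceptional_subset E a _)).trans (ih _)).trans
          (le_mul_of_one_le_left' hn)⟩
      intro E
      rw [pow_succ']
      -- Hold the capital constant until the conditional upper probability drops below `a`.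
      refine upperProb_le_of_hitting (isSuperfarthingale_const _) fun π hπ => ?_
      obtain ⟨n, hn⟩ := hπ.2.exists
      exact ⟨n, (upperProb_mono (continuations_exceptional_subset E a _)).trans (hlt _ hn)⟩
  exact le_zero_iff.1 (ge_of_tendsto' (ENNReal.tendsto_pow_atTop_nhds_zero_of_lt_one ha)
    fun k => key k E)

theorem upperProb_iUnion_eq_zero {N : ℕ → Set Space} (h : ∀ i, upperProb (N i) = 0) :
    upperProb (⋃ i, N i) = 0 := by
  refine le_zero_iff.1 (ENNReal.le_of_forall_pos_le_add fun ε hε _ => ?_)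
  obtain ⟨δ, hδ, hsum⟩ := ENNReal.exists_pos_sum_of_countable
    (ENNReal.coe_ne_zero.2 hε.ne') ℕ
  have hex (i : ℕ) := exists_superfarthingale_of_lt (E := N i) (a := δ i)
    (by rw [h i]; exact_mod_cast hδ i)
  choose V hV hVδ hVN using hex
  refine (upperProb_le_of_limsup (IsSuperfarthingale.tsum hV) fun π hπ => ?_).trans
    ((ENNReal.tsum_le_tsum fun i => (hVδ i).le).trans (hsum.le.trans le_add_self))
  obtain ⟨i, hi⟩ := Set.mem_iUnion.1 hπ
  exact (hVN i π hi).trans (limsup_le_limsup (.of_forall fun n => ENNReal.le_tsum i))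

/-! ### Increasing sequences of arbitrary sets -/

theorem upperProb_iUnion_le {A : ℕ → Set Space} (hA : Monotone A) :
    upperProb (⋃ i, A i) ≤ ⨆ i, upperProb (A i) := by
  obtain ⟨a, -, ha, hlim⟩ := exists_seq_strictMono_tendsto' (zero_lt_one : (0 : ℝ≥0∞) < 1)
  let N : Set Space := ⋃ i, ⋃ k, exceptional (A i) (a k)
  have hN : upperProb N = 0 := upperProb_iUnion_eq_zero fun i =>
    upperProb_iUnion_eq_zero fun k => upperProb_exceptional _ (ha k).2
  have hmono (x : FiniteSeq) : Monotone fun i => upperProb (continuations (A i) x) :=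
    fun i j hij => upperProb_mono fun _ hπ => hA hij hπ
  have hU : IsSuperfarthingale fun x => ⨆ i, upperProb (continuations (A i) x) := fun x p =>
    le_of_tendsto_of_tendsto' (tendsto_average p fun y => tendsto_atTop_iSup (hmono _))
      (tendsto_atTop_iSup (hmono x)) fun i => isSuperfarthingale_upperProb (A i) x p
  refine ENNReal.le_of_forall_pos_le_add fun ε hε _ => ?_
  obtain ⟨W, hW, hWε, hWN⟩ := exists_superfarthingale_of_lt (E := N) (a := ε)
    (by rw [hN]; exact_mod_cast hε)
  refine (upperProb_le_of_limsup (hU.add hW) fun π hπ => ?_).trans (add_le_add_right hWε.le _)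
  by_cases hπN : π ∈ N
  · exact (hWN π hπN).trans (limsup_le_limsup (.of_forall fun n => le_add_self))
  obtain ⟨i, hi⟩ := Set.mem_iUnion.1 hπ
  refine le_of_tendsto' hlim fun k => ?_
  have hk : ¬ ∃ᶠ n in atTop, upperProb (continuations (A i) (initial π n)) < a k :=
    fun hf => hπN (Set.mem_iUnion₂.2 ⟨i, k, hi, hf⟩)
  simp only [not_frequently, not_lt] at hk
  refine le_limsup_of_frequently_le (hk.frequently.mono fun n hn => ?_) (by isBoundedDefault)
  exact hn.trans ((le_iSup (fun i => upperProb (continuations (A i) (initial π n))) i).trans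
    le_self_add)

/-! ### Decreasing sequences of closed sets -/

theorem continuous_cons : Continuous fun q : Round × Space => cons q.1 q.2 := by
  refine continuous_pi fun n => ?_
  cases n with
  | zero => exact continuous_fst
  | succ n => exact (continuous_apply n).comp continuous_snd

/-- The continuations of one-round plays in `L j` with outcome `y` and a forecast that is
`1 / (j + 1)`-close to `p`. -/
def nearContinuations (L : ℕ → Set Space) (p : unitInterval) (y : Fin 2) (j : ℕ) : Set Space :=
  {π | ∃ q : unitInterval, dist q p ≤ 1 / (j + 1 : ℝ) ∧ cons (q, y) π ∈ L j}

section NearContinuations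

variable {L : ℕ → Set Space} (p : unitInterval) (y : Fin 2)

theorem antitone_nearContinuations (hL : Antitone L) : Antitone (nearContinuations L p y) :=
  fun _ _ hij _ ⟨q, hq, hqL⟩ => ⟨q, hq.trans (Nat.one_div_le_one_div hij), hL hij hqL⟩

/-- Projection along the compact space of forecasts is a closed map. -/
theorem isClosed_nearContinuations (hc : ∀ i, IsClosed (L i)) (j : ℕ) :
    IsClosed (nearContinuations L p y j) := by
  have hC : IsClosed {t : unitInterval × Space |
      dist t.1 p ≤ 1 / (j + 1 : ℝ) ∧ cons (t.1, y) t.2 ∈ L j} := by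
    refine (isClosed_le (continuous_fst.dist continuous_const) continuous_const).inter
      ((hc j).preimage ?_)
    exact continuous_cons.comp (by fun_prop : Continuous fun t : unitInterval × Space =>
      (((t.1, y) : Round), t.2))
  convert isClosedMap_snd_of_compactSpace _ hC using 1
  ext π
  simp [nearContinuations]

theorem iInter_nearContinuations_subset (hL : Antitone L) (hc : ∀ i, IsClosed (L i)) :
    ⋂ j, nearContinuations L p y j ⊆ continuations (⋂ i, L i) [(p, y)] := by
  intro π hπ
  choose q hq hqL using Set.mem_iInter.1 hπ
  have hlim : Tendsto q atTop (𝓝 p) := tendsto_iff_dist_tendsto_zero.2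
    (squeeze_zero (fun _ => dist_nonneg) hq tendsto_one_div_add_atTop_nhds_zero_nat)
  refine Set.mem_iInter.2 fun i => ?_
  have hcont : Continuous fun q : unitInterval => cons (q, y) π :=
    continuous_cons.comp (by fun_prop : Continuous fun q : unitInterval => (((q, y) : Round), π))
  exact (hc i).mem_of_tendsto ((hcont.tendsto p).comp hlim)
    ((eventually_ge_atTop i).mono fun j hj => hL hj (hqL j))

end NearContinuations

/-- A good forecast for `L i` depends on `i`; `p` is a cluster point of these. Allowing nearby
forecasts absorbs the move to `p`, and for fixed `j` the average is continuous in the forecast. -/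
theorem exists_le_average_nearContinuations {L : ℕ → Set Space} (hL : Antitone L) {d : ℝ≥0∞}
    (hd : ∀ i, d < upperProb (L i)) :
    ∃ p, d ≤ average p fun y => ⨅ j, upperProb (nearContinuations L p y j) := by
  have hex (i : ℕ) : ∃ q, d < average q fun y => upperProb (continuations (L i) [(q, y)]) := by
    by_contra! h
    exact (hd i).not_ge (upperProb_le_of_average_le h)
  choose q hq using hex
  obtain ⟨p, φ, hφ, hlim⟩ := CompactSpace.tendsto_subseq q
  refine ⟨p, ge_of_tendsto' (tendsto_average p fun y => tendsto_atTop_iInf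
    fun i j hij => upperProb_mono (antitone_nearContinuations p y hL hij)) fun j => ?_⟩
  refine ge_of_tendsto (((continuous_average fun y => upperProb_ne_top
    (nearContinuations L p y j)).tendsto p).comp hlim) ?_
  have hnear : ∀ᶠ i in atTop, dist (q (φ i)) p < 1 / (j + 1 : ℝ) :=
    (tendsto_iff_dist_tendsto_zero.1 hlim).eventually_lt_const Nat.one_div_pos_of_nat
  filter_upwards [hnear, eventually_ge_atTop j] with i hi hij
  refine (hq (φ i)).le.trans ?_
  simp only [Function.comp_apply]
  refine average_mono (q (φ i)) fun y => upperProb_mono fun π hπ => ?_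
  exact ⟨q (φ i), hi.le, hL (hij.trans hφ.le_apply) hπ⟩

/-- A play that extends `x` can keep the capital `V` below the upper probability of the
continuations in some neighbourhood of the closed set `K`. -/
def CanStayBelow (V : FiniteSeq → ℝ≥0∞) (K : Set Space) (x : FiniteSeq) : Prop :=
  ∃ L : ℕ → Set Space, Antitone L ∧ (∀ i, IsClosed (L i)) ∧ ⋂ i, L i ⊆ continuations K x ∧
    V x < ⨅ i, upperProb (L i)

theorem CanStayBelow.exists_append {V : FiniteSeq → ℝ≥0∞} (hV : IsSuperfarthingale V)
    {K : Set Space} {x : FiniteSeq} (h : CanStayBelow V K x) :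
    ∃ r, CanStayBelow V K (x ++ [r]) := by
  obtain ⟨L, hL, hc, hLK, hlt⟩ := h
  obtain ⟨d, hVd, hd⟩ := exists_between hlt
  obtain ⟨p, hp⟩ := exists_le_average_nearContinuations hL
    fun i => hd.trans_le (iInf_le _ i)
  -- Were `V` too large after both outcomes, its average would exceed `V x`.
  obtain ⟨y, hy⟩ : ∃ y, V (x ++ [(p, y)]) < ⨅ j, upperProb (nearContinuations L p y j) := by
    by_contra! hle
    exact (hVd.trans_le (hp.trans (average_mono p hle))).not_ge (hV x p)
  refine ⟨(p, y), nearContinuations L p y, antitone_nearContinuations p y hL,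
    isClosed_nearContinuations p y hc, ?_, hy⟩
  rw [continuations_append]
  exact (iInter_nearContinuations_subset p y hL hc).trans fun _ hπ => hLK hπ

theorem CanStayBelow.nonempty {V : FiniteSeq → ℝ≥0∞} {K : Set Space} {x : FiniteSeq}
    (h : CanStayBelow V K x) : (continuations K x).Nonempty := by
  obtain ⟨L, hL, hc, hLK, hlt⟩ := h
  refine (IsCompact.nonempty_iInter_of_sequence_nonempty_isCompact_isClosed L
    (fun i => hL i.le_succ) (fun i => ?_) (hc 0).isCompact hc).mono hLK
  by_contra hne
  have hi := hlt.trans_le (iInf_le _ i)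
  rw [Set.not_nonempty_iff_eq_empty.1 hne, upperProb_empty] at hi
  exact not_lt_bot hi

theorem CanStayBelow.lt_one {V : FiniteSeq → ℝ≥0∞} {K : Set Space} {x : FiniteSeq}
    (h : CanStayBelow V K x) : V x < 1 := by
  obtain ⟨L, -, -, -, hlt⟩ := h
  exact hlt.trans_le ((iInf_le _ 0).trans (upperProb_le_one _))

theorem exists_forall_initial {Q : FiniteSeq → Prop} (h0 : Q [])
    (hQ : ∀ x, Q x → ∃ r, Q (x ++ [r])) : ∃ π, ∀ n, Q (initial π n) := by
  choose r hr using hQ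
  let s : ℕ → {x // Q x} := fun n => n.rec ⟨[], h0⟩ fun _ x => ⟨x.1 ++ [r x.1 x.2], hr x.1 x.2⟩
  refine ⟨fun n => r (s n).1 (s n).2, fun n => ?_⟩
  suffices h : initial (fun n => r (s n).1 (s n).2) n = (s n).1 by
    rw [h]
    exact (s n).2
  induction n with
  | zero => exact initial_zero _
  | succ n ih => rw [initial_succ, ih]

/-- Points of `K` sharing ever longer prefixes with `π` converge to `π`. -/
theorem mem_of_forall_continuations_nonempty {K : Set Space} (hK : IsClosed K) {π : Space}
    (h : ∀ n, (continuations K (initial π n)).Nonempty) : π ∈ K := by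
  choose ρ hρ using h
  refine hK.mem_of_tendsto (b := atTop) (tendsto_pi_nhds.2 fun k => ?_) (.of_forall hρ)
  exact tendsto_const_nhds.congr' ((eventually_gt_atTop k).mono fun n hn =>
    (prepend_initial_apply π (ρ n) hn).symm)

theorem le_upperProb_iInter {K : ℕ → Set Space} (hK : Antitone K) (hc : ∀ i, IsClosed (K i)) :
    ⨅ i, upperProb (K i) ≤ upperProb (⋂ i, K i) := by
  by_contra! hlt
  obtain ⟨V, hV, hVlt, hhit⟩ := exists_superfarthingale_hitting_of_lt hlt
  obtain ⟨π, hπ⟩ := exists_forall_initial (Q := CanStayBelow V (⋂ i, K i))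
    ⟨K, hK, hc, fun _ h => h, hVlt⟩ fun x hx => hx.exists_append hV
  obtain ⟨n, hn⟩ := hhit π (mem_of_forall_continuations_nonempty (isClosed_iInter hc)
    fun n => (hπ n).nonempty)
  exact (hπ n).lt_one.not_ge hn

end Prequential

theorem theorem3 : Prequential.IsCapacity Prequential.upperProb where
  ne_top := Prequential.upperProb_ne_top
  mono _ _ := Prequential.upperProb_mono
  tendsto_iUnion A hA := by
    have h : ⨆ i, Prequential.upperProb (A i) = Prequential.upperProb (⋃ i, A i) :=
      le_antisymm (iSup_le fun i => Prequential.upperProb_mono (Set.subset_iUnion A i))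
        (Prequential.upperProb_iUnion_le hA)
    rw [← h]
    exact tendsto_atTop_iSup fun i j hij => Prequential.upperProb_mono (hA hij)
  tendsto_iInter K hK hc := by
    have h : ⨅ i, Prequential.upperProb (K i) = Prequential.upperProb (⋂ i, K i) :=
      le_antisymm (Prequential.le_upperProb_iInter hK fun i => (hc i).isClosed)
        (le_iInf fun i => Prequential.upperProb_mono (Set.iInter_subset K i))
    rw [← h]
    exact tendsto_atTop_iInf fun i j hij => Prequential.upperProb_mono (hK hij)
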